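/- **Conventions.** The Birkhoff polytope $B_n\subset\mathbb R^{n\times n}$ is the convex hull of the $n\times n$ permutation matrices. Faces of a polytope include $\emptyset$ and the polytope itself; a facet is a proper face of maximal dimension, where $\emptyset$ has smaller dimension than a point. Two polytopes are combinatorially equivalent if their posets of faces are isomorphic. For a polytope $P$ and a face $A=\{x\in P\mid\langle c,x\rangle=d\}$ of $P$, where $\langle c,x\rangle\le d$ is valid on $P$, put $\wedge_A(P)=\{(x,x_0)\mid x\in P,\ 0\le x_0\le d-\langle c,x\rangle\}$; a polytope is *a wedge of $P$ over $A$* if it is combinatorially equivalent to such a $\wedge_A(P)$. The *complement* of a facet $E$ of $F$ is the convex hull $E^c$ of the vertices of $F$ that are not in $E$. For a bipartite graph $G$ with two layers $\{1,\dots,n\}$, let $\mathrm{face}(G)$ be the convex hull of the permutation matrices of the perfect matchings of $G$; $G$ is a *face graph* if each of its edges lies in a perfect matching. For a face $F$ of $B_n$, the graph $\Gamma(F)$ has an edge from the upper node $i$ to the lower node $j$ if and only if some permutation $\sigma$ with matrix in $F$ has $\sigma(i)=j$. A set $C$ of edges of $\Gamma(F)$ is *facet defining* for a facet $E$ of $F$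 if $\Gamma(F)-C=\Gamma(E)$. Attaching a path of length $3$ to an upper node $u$ and a lower node $v$ means adding a new upper node $u'$, a new lower node $v'$ and the edges $(u,v'),(u',v'),(u',v)$. **Theorem.** Let $n\ge 0$, let $F$ be a face of $B_n$ and $E$ a facet of $F$. Then: 1. $E^c$ is a face of $F$. 2. Every polytope in some $\mathbb R^k$ that is a wedge of $F$ over $E$ or over $E^c$ is combinatorially equivalent to a face of $B_m$ for some $m\ge n$. 3. Let $C$ be the facet defining set of $E$ and $(u,v)\in C$ any edge. - Let $G'$ be obtained from $\Gamma(F)$ by attaching a path of length $3$ to $u$ and $v$. Then $G'$ is a face graph, $\mathrm{face}(G')$ is a face of $B_{n+1}$, and it is a wedge of $F$ over $E$. - Let $G''$ be obtained from $\Gamma(F)$ by replacing the edge $(u,v)$ by a path of length $3$ with new nodes $u',v'$, and then attaching another path of length $3$ to $u'$ and $v'$. Then $\mathrm{face}(G'')$ is a face of $B_{n+2}$, and it is a wedge of $F$ over $E^c$. If $E\ne\emptyset$, then $G''$ is a face graph. -/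

import Mathlib

/-! ### Polytopes, faces, facets, combinatorial types -/

/-- A polytope: the convex hull of finitely many points. -/
def IsPolytope {V : Type*} [AddCommGroup V] [Module ℝ V] (P : Set V) : Prop :=
  ∃ S : Set V, S.Finite ∧ P = convexHull ℝ S

/-- The faces of a polytope `P`, ordered by inclusion: the face
lattice of `P`.  `IsExposed ℝ P A` says that `A` is empty or is the set of maximizers over `P` of
some continuous linear functional; this includes `∅` and `P` itself. -/
abbrev FaceLattice {V : Type*} [TopologicalSpace V] [AddCommGroup V] [Module ℝ V]
    (P : Set V) : Type _ :=
  {A : Set V // IsExposed ℝ P A}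

/-- Two polytopes are combinatorially equivalent if their face lattices are isomorphic as
partially ordered sets. -/
def CombEquiv {V W : Type*} [TopologicalSpace V] [AddCommGroup V] [Module ℝ V]
    [TopologicalSpace W] [AddCommGroup W] [Module ℝ W] (P : Set V) (Q : Set W) : Prop :=
  Nonempty (FaceLattice P ≃o FaceLattice Q)

open Classical in
/-- The dimension of a polytope: the dimension of its affine hull, and `⊥` for the empty
polytope. -/
noncomputable def polytopeDim {V : Type*} [AddCommGroup V] [Module ℝ V] (P : Set V) : WithBot ℕ :=
  if P.Nonempty then ((Module.finrank ℝ (vectorSpan ℝ P) : ℕ) : WithBot ℕ) else ⊥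

/-- A facet of a polytope: a proper face of maximal dimension. -/
def IsFacet {V : Type*} [TopologicalSpace V] [AddCommGroup V] [Module ℝ V]
    (P A : Set V) : Prop :=
  IsExposed ℝ P A ∧ A ≠ P ∧
    ∀ A' : Set V, IsExposed ℝ P A' → A' ≠ P → polytopeDim A' ≤ polytopeDim A

/-- The complement of a face `A` of a polytope `P`: the convex hull of the vertices of `P` that do
not lie in `A`. -/
def faceComplement {V : Type*} [AddCommGroup V] [Module ℝ V] (P A : Set V) : Set V :=
  convexHull ℝ (P.extremePoints ℝ \ A)

/-! ### Wedges -/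

/-- The linear inequality `⟨c, x⟩ ≤ d` is valid on `P` and defines the face `A` of `P`. -/
def DefinesFace {V : Type*} [AddCommGroup V] [Module ℝ V] (c : V →ₗ[ℝ] ℝ) (d : ℝ)
    (P A : Set V) : Prop :=
  (∀ x ∈ P, c x ≤ d) ∧ A = {x ∈ P | c x = d}

/-- The geometric wedge `{(x, x₀) | x ∈ P, 0 ≤ x₀ ≤ d - ⟨c, x⟩}`. -/
def geometricWedge {V : Type*} [AddCommGroup V] [Module ℝ V] (c : V →ₗ[ℝ] ℝ) (d : ℝ)
    (P : Set V) : Set (V × ℝ) :=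
  {p | p.1 ∈ P ∧ 0 ≤ p.2 ∧ p.2 ≤ d - c p.1}

/-- The polytope `W` is a wedge of `P` over the face `A` of `P`: it is combinatorially equivalent
to a geometric wedge of `P` for some linear inequality defining `A`. -/
def IsWedge {V U : Type*} [TopologicalSpace V] [AddCommGroup V] [Module ℝ V]
    [TopologicalSpace U] [AddCommGroup U] [Module ℝ U] (W : Set U) (P A : Set V) : Prop :=
  IsPolytope W ∧ ∃ (c : V →ₗ[ℝ] ℝ) (d : ℝ),
    DefinesFace c d P A ∧ CombEquiv W (geometricWedge c d P)

/-! ### The Birkhoff polytope and face graphs -/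

/-- The `n`-th Birkhoff polytope: the convex hull of the `n × n` permutation matrices. -/
def birkhoffPolytope (n : ℕ) : Set (Matrix (Fin n) (Fin n) ℝ) :=
  convexHull ℝ (Set.range fun σ : Equiv.Perm (Fin n) => σ.permMatrix ℝ)

/-- A bipartite graph with upper layer `Fin n` and lower layer `Fin n`, given by its edges; the
pair `(i, j)` is the edge between the upper node `i` and the lower node `j`. -/
abbrev BipGraph (n : ℕ) : Type := Set (Fin n × Fin n)

/-- The perfect matchings of a bipartite graph; `σ` stands for the matching with the edges
`(i, σ i)`. -/
def BipGraph.perfectMatchings {n : ℕ} (G : BipGraph n) : Set (Equiv.Perm (Fin n)) :=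
  {σ | ∀ i, (i, σ i) ∈ G}

/-- A face graph: every edge is contained in some perfect matching. -/
def BipGraph.IsFaceGraph {n : ℕ} (G : BipGraph n) : Prop :=
  ∀ e ∈ G, ∃ σ ∈ G.perfectMatchings, σ e.1 = e.2

/-- The face of the Birkhoff polytope given by a graph: the convex hull of the permutation
matrices of its perfect matchings. -/
def BipGraph.face {n : ℕ} (G : BipGraph n) : Set (Matrix (Fin n) (Fin n) ℝ) :=
  convexHull ℝ ((fun σ : Equiv.Perm (Fin n) => σ.permMatrix ℝ) '' G.perfectMatchings)

/-- The graph of a face `F` of the Birkhoff polytope: `(i, j)` is an edge if `σ i = j` for some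
permutation `σ` whose matrix lies in `F`. -/
def graphOfFace {n : ℕ} (F : Set (Matrix (Fin n) (Fin n) ℝ)) : BipGraph n :=
  {e | ∃ σ : Equiv.Perm (Fin n), σ.permMatrix ℝ ∈ F ∧ σ e.1 = e.2}

/-- The set `C` of edges is the facet defining set of the facet `E` of `F`: removing `C` from the
graph of `F` leaves the graph of `E`. -/
def IsFacetDefiningSet {n : ℕ} (F E : Set (Matrix (Fin n) (Fin n) ℝ))
    (C : Set (Fin n × Fin n)) : Prop :=
  C ⊆ graphOfFace F ∧ graphOfFace F \ C = graphOfFace E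

/-- Attach a path of length `3` to the upper node `u` and the lower node `v`: the path runs
`u, v', u', v`, where `u'` and `v'` are one new node in each layer. -/
def BipGraph.attachPath {n : ℕ} (G : BipGraph n) (u v : Fin n) : BipGraph (n + 1) :=
  (fun e : Fin n × Fin n => (e.1.castSucc, e.2.castSucc)) '' G ∪
    {(u.castSucc, Fin.last n), (Fin.last n, Fin.last n), (Fin.last n, v.castSucc)}

/-- Replace the edge `(u, v)` by a path of length `3`. -/
def BipGraph.replaceEdge {n : ℕ} (G : BipGraph n) (u v : Fin n) : BipGraph (n + 1) :=
  BipGraph.attachPath (G \ {(u, v)}) u v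

/-- Replace the edge `(u, v)` by a path of length `3`, then attach another path of length `3` to
the two new nodes. -/
def BipGraph.replaceEdgeAttachPath {n : ℕ} (G : BipGraph n) (u v : Fin n) : BipGraph (n + 2) :=
  (G.replaceEdge u v).attachPath (Fin.last n) (Fin.last n)

/-! ### Faces and combinatorial equivalence -/

section Polytopes

variable {V W : Type*} [AddCommGroup V] [Module ℝ V] [TopologicalSpace V]
  [AddCommGroup W] [Module ℝ W] [TopologicalSpace W]

/-! Two facts carry the theorem. The first is that the face lattice of a wedge depends only on the
base `P` and the face `A`, not on the inequality defining `A`. A face of the wedge is recovered from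
its bottom and its top, and the pairs of faces of `P` that arise this way are described without any
inequality (`range_wedgeEnds`). By `DefinesFace.combEquiv_wedge` the inequality may therefore be
chosen at will.

The second is that for a face `F` of the Birkhoff polytope and an edge `(u, v)` of its graph missing
from the graph of the facet `E`, the entry `X u v` alone supplies convenient inequalities: `-X u v ≤
0` defines `E`, because a facet is maximal among proper faces, and `X u v ≤ 1` defines the
complement, because the entry is `0` or `1` at every vertex. In particular the complement is a face.

For these inequalities the wedges are visible in the graph. On a path attached to `u` and `v` the
two outer edges carry a common weight `t` and the middle edge carries `1 - t`. Pushing `t` back onto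
`(u, v)` gives a matrix `X` of `F` with `0 ≤ t ≤ X u v`, which is literally the geometric wedge over
`E`. Subdividing `(u, v)` changes the face only by an affine isomorphism, but creates a middle edge
of weight `1 - X u v`; attaching a path there gives the wedge over the complement. Order zero has no
edges and is treated by hand. -/

theorem IsExposed.exists_definesFace {P A : Set V} (h : IsExposed ℝ P A) (hA : A.Nonempty) :
    ∃ (c : V →ₗ[ℝ] ℝ) (d : ℝ), DefinesFace c d P A := by
  obtain ⟨l, hl⟩ := h hA
  obtain ⟨a, ha⟩ := hA
  have ha' := ha
  rw [hl] at ha'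
  refine ⟨l, l a, fun x hx => ha'.2 x hx, ?_⟩
  ext x
  constructor
  · intro hx
    rw [hl] at hx
    exact ⟨hx.1, le_antisymm (ha'.2 x hx.1) (hx.2 a ha'.1)⟩
  · rintro ⟨hx, hxa⟩
    rw [hl]
    refine ⟨hx, fun y hy => ?_⟩
    have : l x = l a := hxa
    rw [this]
    exact ha'.2 y hy

theorem CombEquiv.symm {P : Set V} {Q : Set W} (h : CombEquiv P Q) : CombEquiv Q P :=
  h.map OrderIso.symm

theorem CombEquiv.trans {U : Type*} [AddCommGroup U] [Module ℝ U] [TopologicalSpace U]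
    {P : Set V} {Q : Set W} {R : Set U} (h : CombEquiv P Q) (h' : CombEquiv Q R) :
    CombEquiv P R :=
  ⟨h.some.trans h'.some⟩

variable [IsTopologicalAddGroup V] [ContinuousSMul ℝ V] [T2Space V] [FiniteDimensional ℝ V]
  [IsTopologicalAddGroup W] [ContinuousSMul ℝ W] [T2Space W] [FiniteDimensional ℝ W]

theorem DefinesFace.isExposed {c : V →ₗ[ℝ] ℝ} {d : ℝ} {P A : Set V} (h : DefinesFace c d P A) :
    IsExposed ℝ P A := by
  rintro ⟨a, ha⟩
  refine ⟨c.toContinuousLinearMap, ?_⟩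
  rw [h.2] at ha ⊢
  ext x
  constructor
  · rintro ⟨hx, hxd⟩
    refine ⟨hx, fun y hy => ?_⟩
    have := h.1 y hy
    simpa [hxd] using this
  · rintro ⟨hx, hmax⟩
    refine ⟨hx, le_antisymm (h.1 x hx) ?_⟩
    have := hmax a ha.1
    simpa [ha.2] using this

theorem isExposed_of_affineMap_le {P A : Set V} (f : V →ᵃ[ℝ] ℝ) (hf : ∀ x ∈ P, f x ≤ 0)
    (hA : A = {x ∈ P | f x = 0}) : IsExposed ℝ P A := by
  have key : ∀ x, f x = f.linear x + f 0 := fun x => congrFun f.decomp x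
  refine DefinesFace.isExposed (c := f.linear) (d := - f 0) ⟨fun x hx => ?_, ?_⟩
  · have := hf x hx
    rw [key] at this
    linarith
  · rw [hA]
    ext x
    have := key x
    simp only [Set.mem_ofPred_eq, and_congr_right_iff]
    intro _
    constructor <;> intro h <;> linarith

omit [IsTopologicalAddGroup V] [ContinuousSMul ℝ V] [T2Space V] [FiniteDimensional ℝ V] in
theorem IsExposed.exists_affineMap_le {P A : Set V} (h : IsExposed ℝ P A) (hA : A.Nonempty) :
    ∃ f : V →ᵃ[ℝ] ℝ, (∀ x ∈ P, f x ≤ 0) ∧ A = {x ∈ P | f x = 0} := by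
  obtain ⟨c, d, h1, h2⟩ := h.exists_definesFace hA
  refine ⟨c.toAffineMap - AffineMap.const ℝ V d, fun x hx => ?_, ?_⟩
  · simpa using h1 x hx
  · rw [h2]
    ext x
    simp [sub_eq_zero]

omit [IsTopologicalAddGroup V] [ContinuousSMul ℝ V] [T2Space V] [FiniteDimensional ℝ V] in
-- The defining functional is pulled back along `g`; `hg` keeps it nonpositive on `Q`. The empty
-- face is separate because it comes with no functional.
theorem IsExposed.preimage_affineMap {P A : Set V} (h : IsExposed ℝ P A) {Q : Set W}
    (g : W →ᵃ[ℝ] V) (hg : Set.MapsTo g Q P) : IsExposed ℝ Q {y ∈ Q | g y ∈ A} := by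
  rcases A.eq_empty_or_nonempty with rfl | hA
  · simpa using isExposed_empty
  obtain ⟨f, h1, h2⟩ := h.exists_affineMap_le hA
  refine isExposed_of_affineMap_le (f.comp g) (fun x hx => h1 _ (hg hx)) ?_
  ext y
  simp only [h2, Set.mem_ofPred_eq, AffineMap.comp_apply]
  exact ⟨fun h => ⟨h.1, h.2.2⟩, fun h => ⟨h.1, hg h.1, h.2⟩⟩

/-- Faces are transported by preimage in both directions, so `f` and `g` need only be mutually
inverse on the polytopes, not on the ambient spaces. -/
theorem CombEquiv.of_affineMap {P : Set V} {Q : Set W} (f : V →ᵃ[ℝ] W) (g : W →ᵃ[ℝ] V)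
    (hf : Set.MapsTo f P Q) (hg : Set.MapsTo g Q P) (hgf : ∀ x ∈ P, g (f x) = x)
    (hfg : ∀ y ∈ Q, f (g y) = y) : CombEquiv P Q := by
  refine ⟨⟨⟨fun A => ⟨_, A.2.preimage_affineMap g hg⟩, fun B => ⟨_, B.2.preimage_affineMap f hf⟩,
    fun A => ?_, fun B => ?_⟩, ?_⟩⟩
  · ext x
    constructor
    · rintro ⟨hx, hx'⟩
      simpa [hgf x hx] using hx'.2
    · intro hx
      have hP := A.2.subset hx
      exact ⟨hP, hf hP, by simpa [hgf x hP] using hx⟩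
  · ext x
    constructor
    · rintro ⟨hx, hx'⟩
      simpa [hfg x hx] using hx'.2
    · intro hx
      have hP := B.2.subset hx
      exact ⟨hP, hg hP, by simpa [hfg x hP] using hx⟩
  · intro A B
    constructor
    · intro h x hx
      have hP := A.2.subset hx
      have := h (show f x ∈ _ from ⟨hf hP, by simpa [hgf x hP] using hx⟩)
      simpa [hgf x hP] using this.2
    · rintro h y ⟨hy, hy'⟩
      exact ⟨hy, h hy'⟩

omit [TopologicalSpace V] [IsTopologicalAddGroup V] [ContinuousSMul ℝ V] [T2Space V]
  [FiniteDimensional ℝ V] in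
-- The points strictly below the hyperplane, together with the hull of the points of `S` on it, form
-- a convex set containing `S`.
theorem setOf_mem_convexHull_eq (S : Set V) (c : V →ₗ[ℝ] ℝ) (d : ℝ) (h : ∀ x ∈ S, c x ≤ d) :
    {x ∈ convexHull ℝ S | c x = d} = convexHull ℝ {x ∈ S | c x = d} := by
  apply Set.Subset.antisymm
  · rintro x ⟨hx, hxd⟩
    have hconv : Convex ℝ {x | c x < d ∨ (c x = d ∧ x ∈ convexHull ℝ {x ∈ S | c x = d})} := by
      rw [convex_iff_forall_pos]
      intro x hx y hy a b ha hb hab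
      simp only [Set.mem_ofPred_eq, map_add, map_smul, smul_eq_mul] at hx hy ⊢
      have hb' : b = 1 - a := by linarith
      rcases hx with hx | ⟨hx, hx'⟩ <;> rcases hy with hy | ⟨hy, hy'⟩
      · left; subst hb'; nlinarith
      · left; subst hb'; nlinarith
      · left; subst hb'; nlinarith
      · right
        refine ⟨by rw [hx, hy, ← add_mul, hab, one_mul], ?_⟩
        exact convex_convexHull ℝ _ hx' hy' ha.le hb.le hab
    have hsub : S ⊆ {x | c x < d ∨ (c x = d ∧ x ∈ convexHull ℝ {x ∈ S | c x = d})} := by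
      intro y hy
      rcases (h y hy).lt_or_eq with h' | h'
      · exact Or.inl h'
      · exact Or.inr ⟨h', subset_convexHull ℝ _ ⟨hy, h'⟩⟩
    rcases convexHull_min hsub hconv hx with h' | h'
    · exact absurd hxd h'.ne
    · exact h'.2
  · refine convexHull_min (fun x hx => ⟨subset_convexHull ℝ _ hx.1, hx.2⟩) ?_
    exact (convex_convexHull ℝ S).inter (convex_hyperplane c.isLinear d)

omit [IsTopologicalAddGroup V] [ContinuousSMul ℝ V] [T2Space V] in
/-- A facet is not contained in a larger proper face. -/
theorem IsFacet.eq_of_subset {P E A : Set V} (hE : IsFacet P E) (hA : IsExposed ℝ P A)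
    (hAP : A ≠ P) (hEA : E ⊆ A) : A = E := by
  by_contra hne
  obtain ⟨x, hxA, hxE⟩ : ∃ x ∈ A, x ∉ E := by
    by_contra! hcon
    exact hne (Set.Subset.antisymm hcon hEA)
  have hdim := hE.2.2 A hA hAP
  have hAne : A.Nonempty := ⟨x, hxA⟩
  -- An empty `E` has dimension `⊥`, below that of any nonempty face.
  rcases E.eq_empty_or_nonempty with rfl | hEne
  · simp [polytopeDim, hAne] at hdim
  · obtain ⟨c, d, h1, h2⟩ := hE.1.exists_definesFace hEne
    simp only [polytopeDim, hAne, hEne, if_true] at hdim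
    refine absurd hdim (not_le.2 ?_)
    refine WithBot.coe_lt_coe.2 (Submodule.finrank_lt_finrank_of_lt ?_)
    refine lt_of_le_of_ne (vectorSpan_mono ℝ hEA) fun heq => ?_
    obtain ⟨y, hy⟩ := hEne
    -- The functional defining `E` is constant on `E`. If both direction spaces agreed, it would be
    -- constant on `A` as well and put `x` into `E`.
    have hle : vectorSpan ℝ E ≤ LinearMap.ker c := by
      rw [vectorSpan_def, Submodule.span_le]
      rintro _ ⟨p, hp, q, hq, rfl⟩
      rw [h2] at hp hq
      simp [hp.2, hq.2]
    have hmem : x -ᵥ y ∈ LinearMap.ker c := by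
      apply hle
      rw [heq]
      exact vsub_mem_vectorSpan ℝ hxA (hEA hy)
    have hcx : c x = c y := by simpa [sub_eq_zero] using hmem
    rw [h2] at hy hxE
    exact hxE ⟨hA.subset hxA, hcx.trans hy.2⟩

/-! ### The face lattice of a wedge -/

/-- The pairs of faces of `P` that a face of a wedge of `P` over `A` has as bottom and top. -/
def wedgeFacePairs (P A : Set V) : Set (Set V × Set V) :=
  {B | IsExposed ℝ P B.1 ∧ IsExposed ℝ P B.2 ∧ B.1 ∩ A = B.2 ∩ A ∧
    (B.1 = B.2 ∨ B.1 ⊆ A ∨ B.2 ⊆ A)}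

/-- The bottom and the top of a subset of a geometric wedge. -/
def wedgeEnds (c : V →ₗ[ℝ] ℝ) (d : ℝ) (H : Set (V × ℝ)) : Set V × Set V :=
  ({x | (x, 0) ∈ H}, {x | (x, d - c x) ∈ H})

section

variable {c : V →ₗ[ℝ] ℝ} {d : ℝ} {P A : Set V}

omit [TopologicalSpace V] [IsTopologicalAddGroup V] [ContinuousSMul ℝ V] [T2Space V]
  [FiniteDimensional ℝ V] in
theorem DefinesFace.mem_wedge_bot (h : DefinesFace c d P A) {x : V} (hx : x ∈ P) :
    (x, (0 : ℝ)) ∈ geometricWedge c d P :=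
  ⟨hx, le_rfl, by simpa using h.1 x hx⟩

omit [TopologicalSpace V] [IsTopologicalAddGroup V] [ContinuousSMul ℝ V] [T2Space V]
  [FiniteDimensional ℝ V] in
theorem DefinesFace.mem_wedge_top (h : DefinesFace c d P A) {x : V} (hx : x ∈ P) :
    (x, d - c x) ∈ geometricWedge c d P :=
  ⟨hx, by simpa using h.1 x hx, le_rfl⟩

omit [IsTopologicalAddGroup V] [ContinuousSMul ℝ V] [T2Space V] [FiniteDimensional ℝ V] in
/-- A face of a wedge is given by an affine functional on the base and a slope. -/
theorem IsExposed.exists_wedge_functional {H : Set (V × ℝ)}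
    (hH : IsExposed ℝ (geometricWedge c d P) H) (hne : H.Nonempty) :
    ∃ (f : V →ᵃ[ℝ] ℝ) (s : ℝ), (∀ p ∈ geometricWedge c d P, f p.1 + s * p.2 ≤ 0) ∧
      H = {p ∈ geometricWedge c d P | f p.1 + s * p.2 = 0} := by
  obtain ⟨l, h1, h2⟩ := hH.exists_affineMap_le hne
  have key : ∀ p : V × ℝ, l p = (l.comp (AffineMap.prod (AffineMap.id ℝ V)
      (AffineMap.const ℝ V 0))) p.1 + l.linear (0, 1) * p.2 := by
    intro p
    have e1 := congrFun l.decomp p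
    have e2 := congrFun l.decomp (p.1, 0)
    have e3 : l.linear p = l.linear (p.1, 0) + l.linear (0, 1) * p.2 := by
      have : p = (p.1, 0) + p.2 • ((0, 1) : V × ℝ) := by ext <;> simp
      conv_lhs => rw [this]
      rw [map_add, map_smul, smul_eq_mul, mul_comm]
    simp only [Pi.add_apply] at e1 e2
    simp only [AffineMap.comp_apply, AffineMap.prod_apply, AffineMap.id_apply,
      AffineMap.const_apply]
    linarith
  refine ⟨_, _, fun p hp => (key p) ▸ h1 p hp, ?_⟩
  rw [h2]
  ext p
  simp only [Set.mem_ofPred_eq, ← key]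

omit [IsTopologicalAddGroup V] [ContinuousSMul ℝ V] [T2Space V] [FiniteDimensional ℝ V] in
-- Over each `x` the wedge is a vertical segment on which the functional is affine and nonpositive,
-- so it vanishes nowhere, at one end, or everywhere. The final disjunction matters only where the
-- segment is a single point and both implications are vacuous.
theorem IsExposed.mem_iff_wedgeEnds (h : DefinesFace c d P A) {H : Set (V × ℝ)}
    (hH : IsExposed ℝ (geometricWedge c d P) H) (p : V × ℝ) :
    p ∈ H ↔ p ∈ geometricWedge c d P ∧ (p.2 < d - c p.1 → p.1 ∈ (wedgeEnds c d H).1) ∧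
      (0 < p.2 → p.1 ∈ (wedgeEnds c d H).2) ∧
      (p.1 ∈ (wedgeEnds c d H).1 ∨ p.1 ∈ (wedgeEnds c d H).2) := by
  rcases H.eq_empty_or_nonempty with rfl | hne
  · simp [wedgeEnds]
  obtain ⟨f, s, h1, h2⟩ := hH.exists_wedge_functional hne
  obtain ⟨x, t⟩ := p
  constructor
  · intro hp
    rw [h2] at hp
    obtain ⟨hp, hp0⟩ := hp
    obtain ⟨hx, ht0, ht1⟩ := hp
    have hb := h1 _ (h.mem_wedge_bot hx)
    have ht := h1 _ (h.mem_wedge_top hx)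
    simp only [mul_zero, add_zero] at hb ht hp0 ht0 ht1 hx
    have hbot : t < d - c x → (x, (0 : ℝ)) ∈ H := by
      intro hlt
      rw [h2]
      refine ⟨h.mem_wedge_bot hx, ?_⟩
      simp only [mul_zero, add_zero]
      by_contra hne
      have : f x < 0 := lt_of_le_of_ne hb hne
      -- With a positive slope, the functional would exceed its value `0` at height `t` on reaching
      -- the top.
      have hs : 0 < s * t := by linarith
      have hs' : 0 < s := by
        by_contra hcon
        nlinarith
      nlinarith
    have htop : 0 < t → (x, d - c x) ∈ H := by
      intro hlt
      rw [h2]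
      refine ⟨h.mem_wedge_top hx, ?_⟩
      refine le_antisymm ht ?_
      simp only
      by_contra hcon
      have hs : s * (d - c x) < s * t := by linarith
      have hs' : s < 0 := by
        by_contra hcon
        nlinarith
      nlinarith
    refine ⟨⟨hx, ht0, ht1⟩, hbot, htop, ?_⟩
    rcases ht1.lt_or_eq with h' | h'
    · exact Or.inl (hbot h')
    · right
      show (x, d - c x) ∈ H
      rw [← h', h2]
      exact ⟨⟨hx, ht0, ht1⟩, hp0⟩
  · rintro ⟨⟨hx, ht0, ht1⟩, hbot, htop, hor⟩
    simp only [wedgeEnds, Set.mem_ofPred_eq] at hbot htop hor ht0 ht1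
    rcases ht0.lt_or_eq with h0 | h0
    · rcases ht1.lt_or_eq with h3 | h3
      · have hb := hbot h3
        have htt := htop h0
        rw [h2] at hb htt ⊢
        refine ⟨⟨hx, ht0, ht1⟩, ?_⟩
        have e1 := hb.2
        have e2 := htt.2
        simp only [mul_zero, add_zero] at e1 e2 ⊢
        have : s * (d - c x) = 0 := by linarith
        rcases mul_eq_zero.1 this with hs | hs
        · rw [hs, e1]; simp
        · linarith
      · rw [h3]
        exact htop h0
    · subst h0
      rcases ht1.lt_or_eq with h3 | h3
      · exact hbot h3
      · rw [← h3] at hor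
        exact hor.elim id id

/-- The sign of the slope decides the case: slope zero makes both ends equal, a positive slope
forces the bottom into `A`, a negative one the top. Conversely, equal ends come from the preimage
under projection. If `B₀ ⊆ A`, the preimage of `B₁` is cut with the top face of the wedge, whose
points over `A` lie at height zero; if `B₁ ⊆ A`, the preimage of `B₀` is cut with the bottom face.
-/
theorem range_wedgeEnds (h : DefinesFace c d P A) :
    Set.range (fun H : FaceLattice (geometricWedge c d P) => wedgeEnds c d H.1) =
      wedgeFacePairs P A := by
  have hbase : ∀ x ∈ P, x ∈ A ↔ c x = d := fun x hx => by rw [h.2]; simp [hx]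
  have hAP : A ⊆ P := by rw [h.2]; exact fun x hx => hx.1
  apply Set.Subset.antisymm
  · rintro _ ⟨⟨H, hH⟩, rfl⟩
    have ebot : (wedgeEnds c d H).1 = {x ∈ P | ((LinearMap.inl ℝ V ℝ).toAffineMap x) ∈ H} := by
      ext x
      exact ⟨fun hx => ⟨(hH.subset hx).1, hx⟩, fun hx => hx.2⟩
    have etop : (wedgeEnds c d H).2 = {x ∈ P | (((AffineMap.id ℝ V).prod
        (AffineMap.const ℝ V d - c.toAffineMap)) x) ∈ H} := by
      ext x
      exact ⟨fun hx => ⟨(hH.subset hx).1, hx⟩, fun hx => hx.2⟩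
    refine ⟨?_, ?_, ?_, ?_⟩
    · rw [ebot]
      exact hH.preimage_affineMap _ fun x hx => h.mem_wedge_bot hx
    · rw [etop]
      exact hH.preimage_affineMap _ fun x hx => h.mem_wedge_top hx
    · ext x
      simp only [wedgeEnds, Set.mem_inter_iff, Set.mem_ofPred_eq, and_congr_left_iff]
      intro hx
      rw [(hbase x (hAP hx)).1 hx, sub_self]
    · rcases H.eq_empty_or_nonempty with rfl | hne
      · left; simp [wedgeEnds]
      obtain ⟨f, s, h1, h2⟩ := hH.exists_wedge_functional hne
      rcases lt_trichotomy s 0 with hs | hs | hs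
      · right; right
        intro x hx
        have hx' : (x, d - c x) ∈ H := hx
        have hxP := (hH.subset hx').1
        rw [hbase x hxP]
        rw [h2] at hx'
        have e1 := hx'.2
        have e2 := h1 _ (h.mem_wedge_bot hxP)
        have e3 := h.1 x hxP
        simp only [mul_zero, add_zero] at e1 e2
        nlinarith
      · left
        subst hs
        ext x
        simp only [wedgeEnds, Set.mem_ofPred_eq, h2, zero_mul, add_zero]
        exact ⟨fun hx => ⟨h.mem_wedge_top hx.1.1, hx.2⟩, fun hx => ⟨h.mem_wedge_bot hx.1.1, hx.2⟩⟩
      · right; left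
        intro x hx
        have hx' : (x, (0 : ℝ)) ∈ H := hx
        have hxP := (hH.subset hx').1
        rw [hbase x hxP]
        rw [h2] at hx'
        have e1 := hx'.2
        have e2 := h1 _ (h.mem_wedge_top hxP)
        have e3 := h.1 x hxP
        simp only [mul_zero, add_zero] at e1 e2
        nlinarith
  · rintro ⟨B₀, B₁⟩ ⟨h0, h1, hA, hor⟩
    dsimp only at h0 h1 hA hor
    have hmem : ∀ x ∈ A, x ∈ B₀ ↔ x ∈ B₁ := by
      intro x hx
      have : x ∈ B₀ ∩ A ↔ x ∈ B₁ ∩ A := by rw [hA]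
      simpa [hx] using this
    rcases hor with rfl | hor | hor
    · refine ⟨⟨_, h0.preimage_affineMap (Q := geometricWedge c d P)
        (LinearMap.fst ℝ V ℝ).toAffineMap fun p hp => hp.1⟩, ?_⟩
      ext x
      · exact ⟨fun hx => hx.2, fun hx => ⟨h.mem_wedge_bot (h0.subset hx), hx⟩⟩
      · exact ⟨fun hx => hx.2, fun hx => ⟨h.mem_wedge_top (h0.subset hx), hx⟩⟩
    · have hexp := (h1.preimage_affineMap (Q := geometricWedge c d P)
        (LinearMap.fst ℝ V ℝ).toAffineMap fun p hp => hp.1).inter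
        (isExposed_of_affineMap_le (P := geometricWedge c d P) (A := {p ∈ geometricWedge c d P |
            ((LinearMap.snd ℝ V ℝ + c ∘ₗ LinearMap.fst ℝ V ℝ).toAffineMap -
              AffineMap.const ℝ (V × ℝ) d) p = 0}) _ (fun p hp => by
          have := hp.2.2
          simp only [AffineMap.coe_sub, LinearMap.coe_toAffineMap, AffineMap.coe_const,
            Pi.sub_apply, LinearMap.add_apply, LinearMap.snd_apply, LinearMap.comp_apply,
            LinearMap.fst_apply, Function.const_apply]
          linarith) rfl)
      refine ⟨⟨_, hexp⟩, ?_⟩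
      ext x
      · constructor
        · rintro ⟨⟨hx, hx1⟩, -, hx2⟩
          have hcx : c x = d := by simpa [sub_eq_zero] using hx2
          exact (hmem x ((hbase x hx.1).2 hcx)).2 hx1
        · intro hx
          have hW := h.mem_wedge_bot (h0.subset hx)
          have hcx : c x = d := (hbase x (h0.subset hx)).1 (hor hx)
          exact ⟨⟨hW, (hmem x (hor hx)).1 hx⟩, hW, by simp [hcx]⟩
      · constructor
        · rintro ⟨⟨hx, hx1⟩, -⟩
          exact hx1
        · intro hx
          have hW := h.mem_wedge_top (h1.subset hx)
          exact ⟨⟨hW, hx⟩, hW, by simp⟩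
    · have hexp := (h0.preimage_affineMap (Q := geometricWedge c d P)
        (LinearMap.fst ℝ V ℝ).toAffineMap fun p hp => hp.1).inter
        (isExposed_of_affineMap_le (P := geometricWedge c d P) (A := {p ∈ geometricWedge c d P |
            (-LinearMap.snd ℝ V ℝ).toAffineMap p = 0}) _ (fun p hp => by
          have := hp.2.1
          simpa using this) rfl)
      refine ⟨⟨_, hexp⟩, ?_⟩
      ext x
      · constructor
        · rintro ⟨⟨hx, hx1⟩, -⟩
          exact hx1
        · intro hx
          have hW := h.mem_wedge_bot (h0.subset hx)
          exact ⟨⟨hW, hx⟩, hW, by simp⟩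
      · constructor
        · rintro ⟨⟨hx, hx1⟩, -, hx2⟩
          have hcx : c x = d := by simpa [sub_eq_zero] using hx2
          exact (hmem x ((hbase x hx.1).2 hcx)).1 hx1
        · intro hx
          have hW := h.mem_wedge_top (h1.subset hx)
          have hcx : c x = d := (hbase x (h1.subset hx)).1 (hor hx)
          exact ⟨⟨hW, (hmem x (hor hx)).2 hx⟩, hW, by simp [hcx]⟩

/-- The face lattice of a geometric wedge is the poset of its pairs of ends. -/
theorem nonempty_faceLattice_wedge_orderIso (h : DefinesFace c d P A) :
    Nonempty (FaceLattice (geometricWedge c d P) ≃o wedgeFacePairs P A) := by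
  have hle : ∀ H K : FaceLattice (geometricWedge c d P),
      wedgeEnds c d H.1 ≤ wedgeEnds c d K.1 ↔ H ≤ K := by
    intro H K
    constructor
    · rintro ⟨h0, h1⟩ p hp
      rw [K.2.mem_iff_wedgeEnds h]
      obtain ⟨hW, hb, ht, hor⟩ := (H.2.mem_iff_wedgeEnds h p).1 hp
      exact ⟨hW, fun h' => h0 (hb h'), fun h' => h1 (ht h'), hor.imp (@h0 _) (@h1 _)⟩
    · intro hHK
      exact ⟨fun x hx => hHK hx, fun x hx => hHK hx⟩
  exact ⟨(OrderEmbedding.ofMapLEIff (fun H : FaceLattice (geometricWedge c d P) =>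
    wedgeEnds c d H.1) hle).orderIso.trans (OrderIso.setCongr _ _ (range_wedgeEnds h))⟩

/-- Both lattices are isomorphic to `wedgeFacePairs P A`, which mentions neither inequality. -/
theorem DefinesFace.combEquiv_wedge (h : DefinesFace c d P A) {c' : V →ₗ[ℝ] ℝ} {d' : ℝ}
    (h' : DefinesFace c' d' P A) :
    CombEquiv (geometricWedge c d P) (geometricWedge c' d' P) :=
  ⟨(nonempty_faceLattice_wedge_orderIso h).some.trans
    (nonempty_faceLattice_wedge_orderIso h').some.symm⟩

end

end Polytopes

/-! ### Faces of the Birkhoff polytope -/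

open Matrix

theorem IsExposed.eq_convexHull_inter {V : Type*} [AddCommGroup V] [Module ℝ V]
    [TopologicalSpace V] {S A : Set V} (h : IsExposed ℝ (convexHull ℝ S) A) :
    A = convexHull ℝ (S ∩ A) := by
  rcases A.eq_empty_or_nonempty with rfl | hA
  · simp
  obtain ⟨c, d, h1, h2⟩ := h.exists_definesFace hA
  have h3 := setOf_mem_convexHull_eq S c d fun x hx => h1 x (subset_convexHull ℝ S hx)
  have h4 : S ∩ A = {x ∈ S | c x = d} := by
    rw [h2]
    ext x
    exact ⟨fun h => ⟨h.1, h.2.2⟩, fun h => ⟨h.1, subset_convexHull ℝ S h.1, h.2⟩⟩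
  rw [h4, ← h3, h2]

section Birkhoff

variable {n : ℕ}

theorem permMatrix_apply_eq_ite (σ : Equiv.Perm (Fin n)) (i j : Fin n) :
    σ.permMatrix ℝ i j = if σ i = j then 1 else 0 := by
  simp [PEquiv.toMatrix_apply, eq_comm]

theorem birkhoffPolytope_eq_doublyStochastic :
    birkhoffPolytope n = (doublyStochastic ℝ (Fin n) : Set (Matrix (Fin n) (Fin n) ℝ)) := by
  rw [doublyStochastic_eq_convexHull_permMatrix]
  rfl

open Classical in
/-- Minus the sum of the entries off the graph. -/
noncomputable def offGraphFunctional (G : BipGraph n) : Matrix (Fin n) (Fin n) ℝ →ₗ[ℝ] ℝ :=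
  -∑ e : Fin n × Fin n, if e ∈ G then 0 else Matrix.entryLinearMap ℝ ℝ e.1 e.2

open Classical in
theorem offGraphFunctional_apply (G : BipGraph n) (X : Matrix (Fin n) (Fin n) ℝ) :
    offGraphFunctional G X = -∑ e : Fin n × Fin n, if e ∈ G then 0 else X e.1 e.2 := by
  simp only [offGraphFunctional, LinearMap.neg_apply, LinearMap.sum_apply]
  congr 1
  refine Finset.sum_congr rfl fun e _ => ?_
  split_ifs <;> simp

theorem offGraphFunctional_nonpos (G : BipGraph n) {X : Matrix (Fin n) (Fin n) ℝ}
    (hX : X ∈ doublyStochastic ℝ (Fin n)) : offGraphFunctional G X ≤ 0 := by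
  classical
  rw [offGraphFunctional_apply, neg_nonpos]
  refine Finset.sum_nonneg fun e _ => ?_
  split_ifs
  · exact le_rfl
  · exact hX.1 _ _

theorem offGraphFunctional_eq_zero_iff (G : BipGraph n) {X : Matrix (Fin n) (Fin n) ℝ}
    (hX : X ∈ doublyStochastic ℝ (Fin n)) :
    offGraphFunctional G X = 0 ↔ ∀ i j, (i, j) ∉ G → X i j = 0 := by
  classical
  rw [offGraphFunctional_apply, neg_eq_zero, Finset.sum_eq_zero_iff_of_nonneg]
  · constructor
    · intro h i j hij
      simpa [hij] using h (i, j) (Finset.mem_univ _)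
    · intro h e _
      split_ifs with he
      · rfl
      · exact h _ _ he
  · intro e _
    split_ifs
    · exact le_rfl
    · exact hX.1 _ _

/-- Entries are nonnegative, so their sum off the graph vanishes only if each of them does; for a
permutation matrix this says that it is a matching of `G`. -/
theorem definesFace_offGraphFunctional (G : BipGraph n) :
    DefinesFace (offGraphFunctional G) 0 (birkhoffPolytope n) G.face := by
  have hle : ∀ X ∈ birkhoffPolytope n, offGraphFunctional G X ≤ 0 := by
    rw [birkhoffPolytope_eq_doublyStochastic]
    exact fun X hX => offGraphFunctional_nonpos G hX
  refine ⟨hle, ?_⟩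
  rw [birkhoffPolytope, setOf_mem_convexHull_eq _ _ _ fun X hX =>
    hle X (subset_convexHull ℝ _ hX), BipGraph.face]
  congr 1
  have key : ∀ σ : Equiv.Perm (Fin n),
      offGraphFunctional G (σ.permMatrix ℝ) = 0 ↔ σ ∈ G.perfectMatchings := by
    intro σ
    rw [offGraphFunctional_eq_zero_iff G permMatrix_mem_doublyStochastic]
    constructor
    · intro h i
      by_contra hi
      simpa [permMatrix_apply_eq_ite] using h i (σ i) hi
    · intro h i j hij
      rw [permMatrix_apply_eq_ite, if_neg]
      rintro rfl
      exact hij (h i)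
  ext X
  constructor
  · rintro ⟨σ, hσ, rfl⟩
    exact ⟨⟨σ, rfl⟩, (key σ).2 hσ⟩
  · rintro ⟨⟨σ, rfl⟩, hσ⟩
    exact ⟨σ, (key σ).1 hσ, rfl⟩

theorem BipGraph.isExposed_face (G : BipGraph n) : IsExposed ℝ (birkhoffPolytope n) G.face :=
  (definesFace_offGraphFunctional G).isExposed

theorem BipGraph.isPolytope_face (G : BipGraph n) : IsPolytope G.face :=
  ⟨_, (Set.toFinite _).image _, rfl⟩

/-- Through Birkhoff's theorem, membership becomes a list of linear conditions on entries, which is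
how the path maps below are verified. -/
theorem BipGraph.mem_face_iff (G : BipGraph n) (X : Matrix (Fin n) (Fin n) ℝ) :
    X ∈ G.face ↔ X ∈ doublyStochastic ℝ (Fin n) ∧ ∀ i j, (i, j) ∉ G → X i j = 0 := by
  rw [(definesFace_offGraphFunctional G).2, birkhoffPolytope_eq_doublyStochastic]
  simp only [Set.mem_ofPred_eq, SetLike.mem_coe]
  exact and_congr_right fun hX => offGraphFunctional_eq_zero_iff G hX

theorem BipGraph.permMatrix_mem_face {G : BipGraph n} {σ : Equiv.Perm (Fin n)}
    (hσ : σ ∈ G.perfectMatchings) : σ.permMatrix ℝ ∈ G.face :=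
  subset_convexHull ℝ _ ⟨σ, hσ, rfl⟩

/-- An edge on which some matrix of the face does not vanish lies in a perfect matching. -/
theorem BipGraph.exists_perfectMatching {G : BipGraph n} {X : Matrix (Fin n) (Fin n) ℝ}
    (hX : X ∈ G.face) {i j : Fin n} (hij : X i j ≠ 0) :
    ∃ σ ∈ G.perfectMatchings, σ i = j := by
  by_contra! hcon
  have hsub : G.face ⊆ {Y | Matrix.entryLinearMap ℝ ℝ i j Y = 0} := by
    refine convexHull_min ?_ (convex_hyperplane (LinearMap.isLinear _) 0)
    rintro _ ⟨σ, hσ, rfl⟩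
    simp [hcon σ hσ]
  exact hij (by simpa using hsub hX)

theorem IsExposed.eq_convexHull_permMatrix {F : Set (Matrix (Fin n) (Fin n) ℝ)}
    (hF : IsExposed ℝ (birkhoffPolytope n) F) :
    F = convexHull ℝ (Set.range (fun σ : Equiv.Perm (Fin n) => σ.permMatrix ℝ) ∩ F) :=
  hF.eq_convexHull_inter

theorem convex_of_isExposed_birkhoffPolytope {F : Set (Matrix (Fin n) (Fin n) ℝ)}
    (hF : IsExposed ℝ (birkhoffPolytope n) F) : Convex ℝ F := by
  rw [hF.eq_convexHull_permMatrix]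
  exact convex_convexHull ℝ _

/-- A perfect matching of the graph of a nonempty extreme convex subset belongs to it. -/
theorem permMatrix_mem_of_mem_perfectMatchings {F : Set (Matrix (Fin n) (Fin n) ℝ)}
    (hF : IsExtreme ℝ (birkhoffPolytope n) F) (hconv : Convex ℝ F) (hne : F.Nonempty)
    {σ : Equiv.Perm (Fin n)} (hσ : σ ∈ (graphOfFace F).perfectMatchings) :
    σ.permMatrix ℝ ∈ F := by
  rcases Nat.eq_zero_or_pos n with rfl | hn
  · obtain ⟨X, hX⟩ := hne
    rwa [Subsingleton.elim (σ.permMatrix ℝ) X]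
  have hn' : (0 : ℝ) < n := by exact_mod_cast hn
  choose τ hτ hτσ using hσ
  -- The average of matrices of `F`, one through each edge of `σ`, is at least `1 / n` on all edges
  -- of `σ`.
  set A : Matrix (Fin n) (Fin n) ℝ := ∑ i, (n : ℝ)⁻¹ • (τ i).permMatrix ℝ with hA
  have hAF : A ∈ F := by
    refine hconv.sum_mem (fun _ _ => by positivity) ?_ fun i _ => hτ i
    simp [hn'.ne']
  have hAB : A ∈ doublyStochastic ℝ (Fin n) := by
    have := hF.subset hAF
    rwa [birkhoffPolytope_eq_doublyStochastic] at this
  -- Below `1 / n`, so that `t • σ` can be subtracted from `A`, and below `1` even for `n = 1`, so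
  -- that the remainder can be normalized.
  set t : ℝ := ((n : ℝ) + 1)⁻¹ with ht
  have ht0 : 0 < t := by positivity
  have ht1 : t < 1 := inv_lt_one_of_one_lt₀ (by linarith)
  have hle : ∀ i j, t * σ.permMatrix ℝ i j ≤ A i j := by
    intro i j
    rw [permMatrix_apply_eq_ite]
    split_ifs with hij
    · have h1 : (n : ℝ)⁻¹ * (τ i).permMatrix ℝ i j ≤ A i j := by
        rw [hA, Matrix.sum_apply]
        refine Finset.single_le_sum (f := fun k => ((n : ℝ)⁻¹ • (τ k).permMatrix ℝ) i j)
          (fun k _ => ?_) (Finset.mem_univ i)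
        simp only [Matrix.smul_apply, permMatrix_apply_eq_ite]
        split_ifs <;> simp
      have h2 : τ i i = j := (hτσ i).trans hij
      rw [permMatrix_apply_eq_ite, if_pos h2] at h1
      refine le_trans ?_ h1
      rw [mul_one, mul_one]
      exact inv_anti₀ hn' (by linarith)
    · simpa using hAB.1 i j
  have hs : 0 < 1 - t := by linarith
  set B : Matrix (Fin n) (Fin n) ℝ := (1 - t)⁻¹ • (A - t • σ.permMatrix ℝ) with hB
  have hσB : σ.permMatrix ℝ ∈ doublyStochastic ℝ (Fin n) := permMatrix_mem_doublyStochastic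
  have hBB : B ∈ doublyStochastic ℝ (Fin n) := by
    rw [mem_doublyStochastic_iff_sum] at hAB hσB ⊢
    refine ⟨fun i j => ?_, fun i => ?_, fun j => ?_⟩
    · have := hle i j
      simp only [hB, Matrix.smul_apply, Matrix.sub_apply, smul_eq_mul]
      exact mul_nonneg (inv_nonneg.2 hs.le) (by linarith)
    · simp only [hB, Matrix.smul_apply, Matrix.sub_apply, smul_eq_mul, ← Finset.mul_sum,
        Finset.sum_sub_distrib, hAB.2.1, hσB.2.1, mul_one]
      exact inv_mul_cancel₀ hs.ne'
    · simp only [hB, Matrix.smul_apply, Matrix.sub_apply, smul_eq_mul, ← Finset.mul_sum,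
        Finset.sum_sub_distrib, hAB.2.2, hσB.2.2, mul_one]
      exact inv_mul_cancel₀ hs.ne'
  -- `A` is a proper convex combination of `σ` and `B`, so extremality puts `σ` into `F`.
  rw [birkhoffPolytope_eq_doublyStochastic] at hF
  refine hF.left_mem_of_mem_openSegment hσB hBB hAF ⟨t, 1 - t, ht0, hs, by ring, ?_⟩
  rw [hB, smul_smul, mul_inv_cancel₀ hs.ne', one_smul]
  abel

/-- Nonemptiness matters in order zero: there the graph of the empty face still has the empty
perfect matching. -/
theorem face_graphOfFace {F : Set (Matrix (Fin n) (Fin n) ℝ)}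
    (hF : IsExposed ℝ (birkhoffPolytope n) F) (hne : F.Nonempty) :
    (graphOfFace F).face = F := by
  conv_rhs => rw [hF.eq_convexHull_permMatrix]
  rw [BipGraph.face]
  congr 1
  ext X
  constructor
  · rintro ⟨σ, hσ, rfl⟩
    exact ⟨⟨σ, rfl⟩, permMatrix_mem_of_mem_perfectMatchings hF.isExtreme
      (convex_of_isExposed_birkhoffPolytope hF) hne hσ⟩
  · rintro ⟨⟨σ, rfl⟩, hσ⟩
    exact ⟨σ, fun i => ⟨σ, hσ, rfl⟩, rfl⟩

theorem isFaceGraph_graphOfFace {F : Set (Matrix (Fin n) (Fin n) ℝ)} :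
    (graphOfFace F).IsFaceGraph := by
  rintro e ⟨σ, hσ, he⟩
  exact ⟨σ, fun i => ⟨σ, hσ, rfl⟩, he⟩

theorem IsFacet.nonempty {F E : Set (Matrix (Fin n) (Fin n) ℝ)} (hE : IsFacet F E) :
    F.Nonempty := by
  rw [Set.nonempty_iff_ne_empty]
  rintro rfl
  exact hE.2.1 (Set.subset_empty_iff.1 hE.1.subset)

/-! ### Facets, their complements and their missing edges -/

section Facet

variable {F E : Set (Matrix (Fin n) (Fin n) ℝ)}

theorem IsFacet.eq_convexHull_permMatrix (hF : IsExposed ℝ (birkhoffPolytope n) F)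
    (hE : IsFacet F E) :
    E = convexHull ℝ (Set.range (fun σ : Equiv.Perm (Fin n) => σ.permMatrix ℝ) ∩ E) := by
  have h := hE.1
  rw [hF.eq_convexHull_permMatrix] at h
  have h' := h.eq_convexHull_inter
  rwa [Set.inter_assoc, Set.inter_eq_right.2 hE.1.subset] at h'

theorem IsFacet.exists_edge (hF : IsExposed ℝ (birkhoffPolytope n) F) (hE : IsFacet F E)
    (hn : 0 < n) : ∃ u v, (u, v) ∈ graphOfFace F ∧ (u, v) ∉ graphOfFace E := by
  by_contra! hcon
  have hFE : ∀ σ : Equiv.Perm (Fin n), σ.permMatrix ℝ ∈ F → σ.permMatrix ℝ ∈ E := by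
    intro σ hσ
    have hσE : σ ∈ (graphOfFace E).perfectMatchings := fun i => hcon _ _ ⟨σ, hσ, rfl⟩
    -- Some node is needed to see that `E` is nonempty.
    obtain ⟨τ, hτ, -⟩ := hσE ⟨0, hn⟩
    refine permMatrix_mem_of_mem_perfectMatchings (hF.isExtreme.trans hE.1.isExtreme) ?_
      ⟨_, hτ⟩ hσE
    rw [hE.eq_convexHull_permMatrix hF]
    exact convex_convexHull ℝ _
  refine hE.2.1 (Set.Subset.antisymm hE.1.subset ?_)
  rw [hF.eq_convexHull_permMatrix, hE.eq_convexHull_permMatrix hF]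
  refine convexHull_mono ?_
  rintro _ ⟨⟨σ, rfl⟩, hσ⟩
  exact ⟨⟨σ, rfl⟩, hFE σ hσ⟩

variable {u v : Fin n}

/-- A facet consists of the matrices vanishing at any edge of its facet defining set. -/
theorem IsFacet.definesFace (hF : IsExposed ℝ (birkhoffPolytope n) F) (hE : IsFacet F E)
    (huF : (u, v) ∈ graphOfFace F) (huE : (u, v) ∉ graphOfFace E) :
    DefinesFace (-Matrix.entryLinearMap ℝ ℝ u v) 0 F E := by
  have hdef : DefinesFace (-Matrix.entryLinearMap ℝ ℝ u v) 0 F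
      {X ∈ F | (-Matrix.entryLinearMap ℝ ℝ u v) X = 0} := by
    refine ⟨fun X hX => ?_, rfl⟩
    have hX' := hF.subset hX
    rw [birkhoffPolytope_eq_doublyStochastic] at hX'
    simpa using hX'.1 u v
  -- The face `X u v = 0` is proper since some matching of `F` uses `(u, v)`, and contains `E` since
  -- none of `E` does.
  have heq : {X ∈ F | (-Matrix.entryLinearMap ℝ ℝ u v) X = 0} = E := by
    refine hE.eq_of_subset hdef.isExposed (fun h => ?_) fun X hX => ⟨hE.1.subset hX, ?_⟩
    · obtain ⟨σ, hσ, huv⟩ := huF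
      rw [← h] at hσ
      have h2 := hσ.2
      dsimp only at huv
      simp [huv] at h2
    · rw [hE.eq_convexHull_permMatrix hF] at hX
      refine convexHull_min (t := {X | (-Matrix.entryLinearMap ℝ ℝ u v) X = 0}) ?_
        (convex_hyperplane (LinearMap.isLinear _) 0) hX
      rintro _ ⟨⟨σ, rfl⟩, hσ⟩
      have : σ u ≠ v := fun h => huE ⟨σ, hσ, h⟩
      simp [this]
  rwa [heq] at hdef

theorem IsExposed.extremePoints_birkhoffPolytope (hF : IsExposed ℝ (birkhoffPolytope n) F) :
    F.extremePoints ℝ = Set.range (fun σ : Equiv.Perm (Fin n) => σ.permMatrix ℝ) ∩ F := by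
  apply Set.Subset.antisymm
  · conv_lhs => rw [hF.eq_convexHull_permMatrix]
    exact extremePoints_convexHull_subset
  · rintro X ⟨⟨σ, rfl⟩, hX⟩
    refine inter_extremePoints_subset_extremePoints_of_subset hF.subset ⟨hX, ?_⟩
    rw [birkhoffPolytope_eq_doublyStochastic, extremePoints_doublyStochastic]
    exact ⟨σ, rfl⟩

/-- At a vertex the entry is `0` or `1`, and `E` is where it is `0`; the vertices outside `E` are
thus those where it attains the bound `1`. -/
theorem IsFacet.definesFace_faceComplement (hF : IsExposed ℝ (birkhoffPolytope n) F)
    (hE : IsFacet F E) (huF : (u, v) ∈ graphOfFace F) (huE : (u, v) ∉ graphOfFace E) :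
    DefinesFace (Matrix.entryLinearMap ℝ ℝ u v) 1 F (faceComplement F E) := by
  have hle : ∀ X ∈ F, Matrix.entryLinearMap ℝ ℝ u v X ≤ 1 := by
    intro X hX
    have hX' := hF.subset hX
    rw [birkhoffPolytope_eq_doublyStochastic] at hX'
    simpa using le_one_of_mem_doublyStochastic hX'
  refine ⟨hle, ?_⟩
  have h := setOf_mem_convexHull_eq
    (Set.range (fun σ : Equiv.Perm (Fin n) => σ.permMatrix ℝ) ∩ F)
    (Matrix.entryLinearMap ℝ ℝ u v) 1 fun X hX => hle X hX.2
  rw [← hF.eq_convexHull_permMatrix] at h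
  rw [h, faceComplement, hF.extremePoints_birkhoffPolytope]
  congr 1
  have hmem : ∀ X ∈ F, X ∈ E ↔ X u v = 0 := by
    intro X hX
    rw [(hE.definesFace hF huF huE).2]
    simp [hX]
  ext X
  constructor
  · rintro ⟨⟨⟨σ, rfl⟩, hX⟩, hXE⟩
    refine ⟨⟨⟨σ, rfl⟩, hX⟩, ?_⟩
    rw [hmem _ hX] at hXE
    simp only [permMatrix_apply_eq_ite, Matrix.entryLinearMap_apply] at hXE ⊢
    by_contra h'
    simp_all
  · rintro ⟨hX, hX1⟩
    refine ⟨hX, fun hXE => ?_⟩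
    rw [hmem _ hX.2] at hXE
    simp [hXE] at hX1

end Facet

/-! ### Attaching paths -/

/-- Contract the path attached to `u` and `v`; the second component is the weight of the path. -/
def collapsePath (u v : Fin n) :
    Matrix (Fin (n + 1)) (Fin (n + 1)) ℝ →ₗ[ℝ] Matrix (Fin n) (Fin n) ℝ × ℝ where
  toFun Y := (Matrix.of fun i j => Y i.castSucc j.castSucc +
    if i = u ∧ j = v then Y u.castSucc (Fin.last n) else 0, Y u.castSucc (Fin.last n))
  map_add' Y Z := by
    ext i j
    · simp only [Matrix.add_apply, Matrix.of_apply, Prod.fst_add]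
      split_ifs <;> ring
    · rfl
  map_smul' a Y := by
    ext i j
    · simp only [Matrix.smul_apply, Matrix.of_apply, Prod.smul_fst, smul_eq_mul, RingHom.id_apply]
      split_ifs <;> ring
    · rfl

/-- Move the weight `t` from the edge `(u, v)` to a path attached to `u` and `v`. -/
def expandPath (u v : Fin n) :
    Matrix (Fin n) (Fin n) ℝ × ℝ →ₗ[ℝ] Matrix (Fin (n + 1)) (Fin (n + 1)) ℝ where
  toFun p := Matrix.of fun i => Fin.lastCases
    -- On doubly stochastic matrices the row sum is `1`, so the middle edge gets `1 - t`; writing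
    -- the row sum keeps the map linear.
    (fun j => Fin.lastCases (∑ k, p.1 u k - p.2) (fun j => if j = v then p.2 else 0) j)
    (fun i j => Fin.lastCases (if i = u then p.2 else 0)
      (fun j => p.1 i j - if i = u ∧ j = v then p.2 else 0) j) i
  map_add' p q := by
    ext i j
    refine Fin.lastCases ?_ (fun i => ?_) i <;> refine Fin.lastCases ?_ (fun j => ?_) j <;>
      simp only [Fin.lastCases_last, Fin.lastCases_castSucc, Prod.fst_add, Prod.snd_add,
        Matrix.add_apply, Matrix.of_apply, Finset.sum_add_distrib] <;>
      (try split_ifs) <;> ring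
  map_smul' a p := by
    ext i j
    refine Fin.lastCases ?_ (fun i => ?_) i <;> refine Fin.lastCases ?_ (fun j => ?_) j <;>
      simp only [Fin.lastCases_last, Fin.lastCases_castSucc, Prod.smul_fst, Prod.smul_snd,
        Matrix.smul_apply, Matrix.of_apply, smul_eq_mul, ← Finset.mul_sum, RingHom.id_apply] <;>
      (try split_ifs) <;> ring

section Path

variable (u v : Fin n) (p : Matrix (Fin n) (Fin n) ℝ × ℝ)
  (Y : Matrix (Fin (n + 1)) (Fin (n + 1)) ℝ)

theorem collapsePath_fst_apply (i j : Fin n) : (collapsePath u v Y).1 i j =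
    Y i.castSucc j.castSucc + if i = u ∧ j = v then Y u.castSucc (Fin.last n) else 0 :=
  rfl

theorem collapsePath_snd : (collapsePath u v Y).2 = Y u.castSucc (Fin.last n) :=
  rfl

theorem expandPath_last_last :
    expandPath u v p (Fin.last n) (Fin.last n) = ∑ k, p.1 u k - p.2 := by
  simp [expandPath]

theorem expandPath_last_castSucc (j : Fin n) :
    expandPath u v p (Fin.last n) j.castSucc = if j = v then p.2 else 0 := by
  simp [expandPath]

theorem expandPath_castSucc_last (i : Fin n) :
    expandPath u v p i.castSucc (Fin.last n) = if i = u then p.2 else 0 := by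
  simp [expandPath]

theorem expandPath_castSucc_castSucc (i j : Fin n) :
    expandPath u v p i.castSucc j.castSucc = p.1 i j - if i = u ∧ j = v then p.2 else 0 := by
  simp [expandPath]

theorem collapsePath_expandPath : collapsePath u v (expandPath u v p) = p := by
  ext i j
  · rw [collapsePath_fst_apply, expandPath_castSucc_castSucc, expandPath_castSucc_last, if_pos rfl]
    ring
  · rw [collapsePath_snd, expandPath_castSucc_last, if_pos rfl]

end Path

/-! ### Faces of graphs with attached paths as wedges -/

namespace BipGraph

variable {G : BipGraph n} {u v : Fin n}

theorem mem_attachPath_castSucc_castSucc (i j : Fin n) :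
    (i.castSucc, j.castSucc) ∈ G.attachPath u v ↔ (i, j) ∈ G := by
  simp [attachPath, Fin.castSucc_ne_last]

theorem mem_attachPath_castSucc_last (i : Fin n) :
    (i.castSucc, Fin.last n) ∈ G.attachPath u v ↔ i = u := by
  simp [attachPath, Fin.castSucc_ne_last]

theorem mem_attachPath_last_castSucc (j : Fin n) :
    (Fin.last n, j.castSucc) ∈ G.attachPath u v ↔ j = v := by
  simp [attachPath, Fin.castSucc_ne_last]

theorem mem_attachPath_last_last : (Fin.last n, Fin.last n) ∈ G.attachPath u v := by
  simp [attachPath]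

/-- The pairs of a matrix and a path weight that correspond to the matrices of
`(G.attachPath u v).face`. -/
def pathWeights (G : BipGraph n) (u v : Fin n) : Set (Matrix (Fin n) (Fin n) ℝ × ℝ) :=
  {p | p.1 ∈ (G ∪ {(u, v)} : BipGraph n).face ∧ 0 ≤ p.2 ∧ p.2 ≤ p.1 u v ∧
    ((u, v) ∉ G → p.1 u v = p.2)}

/-- `pathWeights` serves both constructions: with `(u, v)` in `G` the weight is split freely between
edge and path, and with `(u, v)` deleted the path must carry all of it. -/
theorem expandPath_mapsTo :
    Set.MapsTo (expandPath u v) (G.pathWeights u v) (G.attachPath u v).face := by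
  rintro ⟨X, t⟩ ⟨hX, ht0, ht1, ht⟩
  rw [mem_face_iff, mem_doublyStochastic_iff_sum] at hX
  obtain ⟨⟨h0, hr, hc⟩, hs⟩ := hX
  dsimp only at h0 hr hc hs ht0 ht1 ht
  have huv : X u v ≤ 1 := by
    rw [← hr u]
    exact Finset.single_le_sum (fun k _ => h0 _ k) (Finset.mem_univ v)
  rw [mem_face_iff, mem_doublyStochastic_iff_sum]
  refine ⟨⟨fun i j => ?_, fun i => ?_, fun j => ?_⟩, fun i j => ?_⟩
  · refine Fin.lastCases ?_ (fun i => ?_) i <;> refine Fin.lastCases ?_ (fun j => ?_) j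
    · rw [expandPath_last_last, hr]
      dsimp only
      linarith
    · rw [expandPath_last_castSucc]
      split_ifs
      · exact ht0
      · exact le_rfl
    · rw [expandPath_castSucc_last]
      split_ifs
      · exact ht0
      · exact le_rfl
    · rw [expandPath_castSucc_castSucc]
      split_ifs with h
      · rw [h.1, h.2]
        exact sub_nonneg.2 ht1
      · simpa using h0 i j
  · rw [Fin.sum_univ_castSucc]
    refine Fin.lastCases ?_ (fun i => ?_) i
    · simp [expandPath_last_last, expandPath_last_castSucc, hr]
    · simp only [expandPath_castSucc_last, expandPath_castSucc_castSucc, Finset.sum_sub_distrib, hr]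
      by_cases h : i = u <;> simp [h]
  · rw [Fin.sum_univ_castSucc]
    refine Fin.lastCases ?_ (fun j => ?_) j
    · simp [expandPath_last_last, expandPath_castSucc_last, hr]
    · simp only [expandPath_last_castSucc, expandPath_castSucc_castSucc, Finset.sum_sub_distrib, hc]
      by_cases h : j = v <;> simp [h]
  · refine Fin.lastCases ?_ (fun i => ?_) i <;> refine Fin.lastCases ?_ (fun j => ?_) j
    · intro h
      exact absurd mem_attachPath_last_last h
    · rw [mem_attachPath_last_castSucc, expandPath_last_castSucc]
      exact fun h => if_neg h
    · rw [mem_attachPath_castSucc_last, expandPath_castSucc_last]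
      exact fun h => if_neg h
    · rw [mem_attachPath_castSucc_castSucc, expandPath_castSucc_castSucc]
      intro h
      by_cases h' : i = u ∧ j = v
      · obtain ⟨rfl, rfl⟩ := h'
        simp [ht h]
      · rw [if_neg h', sub_zero]
        refine hs i j ?_
        simp [h, h']

/-- The new nodes have degree two, so their row and column sums give the outer path edges equal
weight and the middle edge the rest. Contraction therefore preserves the sums at `u` and `v` and
loses no information. -/
theorem collapsePath_mapsTo_and_expandPath_collapsePath
    {Y : Matrix (Fin (n + 1)) (Fin (n + 1)) ℝ} (hY : Y ∈ (G.attachPath u v).face) :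
    collapsePath u v Y ∈ G.pathWeights u v ∧ expandPath u v (collapsePath u v Y) = Y := by
  rw [mem_face_iff, mem_doublyStochastic_iff_sum] at hY
  obtain ⟨⟨h0, hr, hc⟩, hs⟩ := hY
  have hcl : ∀ i : Fin n, i ≠ u → Y i.castSucc (Fin.last n) = 0 := fun i hi =>
    hs _ _ fun h => hi ((mem_attachPath_castSucc_last i).1 h)
  have hlc : ∀ j : Fin n, j ≠ v → Y (Fin.last n) j.castSucc = 0 := fun j hj =>
    hs _ _ fun h => hj ((mem_attachPath_last_castSucc j).1 h)
  have hcol : Y u.castSucc (Fin.last n) + Y (Fin.last n) (Fin.last n) = 1 := by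
    have := hc (Fin.last n)
    rwa [Fin.sum_univ_castSucc, Finset.sum_eq_single u (fun i _ hi => hcl i hi) (by simp)] at this
  have hrow : Y (Fin.last n) v.castSucc + Y (Fin.last n) (Fin.last n) = 1 := by
    have := hr (Fin.last n)
    rwa [Fin.sum_univ_castSucc, Finset.sum_eq_single v (fun i _ hi => hlc i hi) (by simp)] at this
  have hrX : ∀ i, ∑ j, (collapsePath u v Y).1 i j = 1 := by
    intro i
    have := hr i.castSucc
    rw [Fin.sum_univ_castSucc] at this
    simp only [collapsePath_fst_apply, Finset.sum_add_distrib]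
    rw [← this]
    by_cases h : i = u
    · simp [h]
    · simp [h, hcl i h]
  have hcX : ∀ j, ∑ i, (collapsePath u v Y).1 i j = 1 := by
    intro j
    have := hc j.castSucc
    rw [Fin.sum_univ_castSucc] at this
    simp only [collapsePath_fst_apply, Finset.sum_add_distrib]
    rw [← this]
    by_cases h : j = v
    · simp only [h, and_true, Finset.sum_ite_eq', Finset.mem_univ, if_true]
      linarith
    · simp [h, hlc j h]
  refine ⟨⟨?_, h0 _ _, ?_, ?_⟩, ?_⟩
  · rw [mem_face_iff, mem_doublyStochastic_iff_sum]
    refine ⟨⟨fun i j => ?_, hrX, hcX⟩, fun i j hij => ?_⟩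
    · rw [collapsePath_fst_apply]
      refine add_nonneg (h0 _ _) ?_
      split_ifs
      · exact h0 _ _
      · exact le_rfl
    · have h1 : (i, j) ∉ G := fun h => hij (Or.inl h)
      have h2 : ¬(i = u ∧ j = v) := fun h => hij (Or.inr (by simp [h]))
      rw [collapsePath_fst_apply, if_neg h2, add_zero]
      exact hs _ _ fun h => h1 ((mem_attachPath_castSucc_castSucc i j).1 h)
  · rw [collapsePath_fst_apply, collapsePath_snd, if_pos ⟨rfl, rfl⟩]
    linarith [h0 u.castSucc v.castSucc]
  · intro h
    rw [collapsePath_fst_apply, collapsePath_snd, if_pos ⟨rfl, rfl⟩,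
      hs _ _ fun h' => h ((mem_attachPath_castSucc_castSucc u v).1 h'), zero_add]
  · ext i j
    refine Fin.lastCases ?_ (fun i => ?_) i <;> refine Fin.lastCases ?_ (fun j => ?_) j
    · rw [expandPath_last_last, hrX, collapsePath_snd]
      linarith
    · rw [expandPath_last_castSucc, collapsePath_snd]
      split_ifs with h
      · rw [h]
        linarith
      · exact (hlc j h).symm
    · rw [expandPath_castSucc_last, collapsePath_snd]
      split_ifs with h
      · rw [h]
      · exact (hcl i h).symm
    · rw [expandPath_castSucc_castSucc, collapsePath_fst_apply, collapsePath_snd]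
      ring

theorem pathWeights_eq_geometricWedge (huv : (u, v) ∈ G) :
    G.pathWeights u v = geometricWedge (-Matrix.entryLinearMap ℝ ℝ u v) 0 G.face := by
  have h : (G ∪ {(u, v)} : BipGraph n) = G := by simpa using huv
  ext p
  simp [pathWeights, geometricWedge, h, huv]

/-- Attaching a path to the ends of an edge is a wedge over the face where the edge vanishes. -/
theorem combEquiv_face_attachPath (huv : (u, v) ∈ G) :
    CombEquiv (G.attachPath u v).face
      (geometricWedge (-Matrix.entryLinearMap ℝ ℝ u v) 0 G.face) := by
  rw [← pathWeights_eq_geometricWedge huv]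
  exact CombEquiv.of_affineMap (collapsePath u v).toAffineMap (expandPath u v).toAffineMap
    (fun Y hY => (collapsePath_mapsTo_and_expandPath_collapsePath hY).1) expandPath_mapsTo
    (fun Y hY => (collapsePath_mapsTo_and_expandPath_collapsePath hY).2)
    fun p _ => collapsePath_expandPath u v p

/-- Move the whole weight of the edge `(u, v)` to the path that replaces it. -/
def subdivide (u v : Fin n) :
    Matrix (Fin n) (Fin n) ℝ →ₗ[ℝ] Matrix (Fin (n + 1)) (Fin (n + 1)) ℝ :=
  expandPath u v ∘ₗ LinearMap.id.prod (Matrix.entryLinearMap ℝ ℝ u v)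

theorem subdivide_apply (X : Matrix (Fin n) (Fin n) ℝ) :
    subdivide u v X = expandPath u v (X, X u v) :=
  rfl

theorem subdivide_mapsTo (huv : (u, v) ∈ G) :
    Set.MapsTo (subdivide u v) G.face (G.replaceEdge u v).face := by
  intro X hX
  refine expandPath_mapsTo ⟨?_, ?_, le_rfl, fun _ => rfl⟩
  · have h : (G \ {(u, v)} ∪ {(u, v)} : BipGraph n) = G := by simpa using huv
    rwa [h]
  · exact ((G.mem_face_iff X).1 hX).1.1 u v

theorem collapsePath_mapsTo_and_subdivide_collapsePath (huv : (u, v) ∈ G)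
    {Y : Matrix (Fin (n + 1)) (Fin (n + 1)) ℝ} (hY : Y ∈ (G.replaceEdge u v).face) :
    (collapsePath u v Y).1 ∈ G.face ∧ subdivide u v (collapsePath u v Y).1 = Y := by
  obtain ⟨⟨h1, -, -, h2⟩, h3⟩ := collapsePath_mapsTo_and_expandPath_collapsePath hY
  have h : (G \ {(u, v)} ∪ {(u, v)} : BipGraph n) = G := by simpa using huv
  refine ⟨by rwa [h] at h1, ?_⟩
  rw [subdivide_apply, h2 (by simp)]
  exact h3

/-- This is the purpose of subdividing: the middle edge vanishes exactly where `X u v = 1`. -/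
theorem subdivide_last_last {X : Matrix (Fin n) (Fin n) ℝ} (hX : X ∈ G.face) :
    subdivide u v X (Fin.last n) (Fin.last n) = 1 - X u v := by
  rw [subdivide_apply, expandPath_last_last,
    sum_row_of_mem_doublyStochastic ((G.mem_face_iff X).1 hX).1]

/-- The attached path gives a wedge whose height is bounded by the weight of the middle edge, and
the subdivision isomorphism turns that bound into `1 - X u v`. -/
theorem combEquiv_face_replaceEdgeAttachPath (huv : (u, v) ∈ G) :
    CombEquiv (G.replaceEdgeAttachPath u v).face
      (geometricWedge (Matrix.entryLinearMap ℝ ℝ u v) 1 G.face) := by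
  refine (combEquiv_face_attachPath mem_attachPath_last_last).trans ?_
  refine CombEquiv.of_affineMap
    ((LinearMap.fst ℝ _ ℝ ∘ₗ collapsePath u v).prodMap LinearMap.id).toAffineMap
    ((subdivide u v).prodMap LinearMap.id).toAffineMap ?_ ?_ ?_ ?_
  · rintro ⟨Y, t⟩ ⟨hY, h0, h1⟩
    obtain ⟨h2, h3⟩ := collapsePath_mapsTo_and_subdivide_collapsePath huv hY
    refine ⟨h2, h0, ?_⟩
    have h4 := subdivide_last_last (u := u) (v := v) h2
    rw [h3] at h4
    have h5 : t ≤ Y (Fin.last n) (Fin.last n) := by simpa using h1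
    exact h5.trans_eq h4
  · rintro ⟨X, t⟩ ⟨hX, h0, h1⟩
    refine ⟨subdivide_mapsTo huv hX, h0, ?_⟩
    have h4 := subdivide_last_last (u := u) (v := v) hX
    simpa [h4] using h1
  · rintro ⟨Y, t⟩ ⟨hY, -, -⟩
    exact Prod.ext (collapsePath_mapsTo_and_subdivide_collapsePath huv hY).2 rfl
  · rintro ⟨X, t⟩ -
    have h := congrArg Prod.fst (collapsePath_expandPath u v (X, X u v))
    exact Prod.ext h rfl

/-- Path weight `0` extends each matching by the middle edge; path weight `1`, for a matching
through `(u, v)`, uses the two outer edges. -/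
theorem IsFaceGraph.attachPath (hG : G.IsFaceGraph) (huv : (u, v) ∈ G) :
    (G.attachPath u v).IsFaceGraph := by
  have hunion : (G ∪ {(u, v)} : BipGraph n) = G := by simpa using huv
  have h0 : ∀ σ ∈ G.perfectMatchings,
      expandPath u v (σ.permMatrix ℝ, 0) ∈ (G.attachPath u v).face := by
    intro σ hσ
    refine expandPath_mapsTo ⟨?_, le_rfl, ?_, fun h => absurd huv h⟩
    · rw [hunion]
      exact permMatrix_mem_face hσ
    · exact permMatrix_mem_doublyStochastic.1 u v
  obtain ⟨τ, hτ, hτuv⟩ := hG _ huv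
  have h1 : expandPath u v (τ.permMatrix ℝ, 1) ∈ (G.attachPath u v).face := by
    refine expandPath_mapsTo ⟨?_, zero_le_one, ?_, fun h => absurd huv h⟩
    · rw [hunion]
      exact permMatrix_mem_face hτ
    · dsimp only at hτuv ⊢
      rw [permMatrix_apply_eq_ite, if_pos hτuv]
  rintro ⟨i, j⟩
  refine Fin.lastCases ?_ (fun i => ?_) i <;> refine Fin.lastCases ?_ (fun j => ?_) j <;> intro h
  · refine exists_perfectMatching (h0 τ hτ) ?_
    rw [expandPath_last_last, sum_row_of_mem_doublyStochastic permMatrix_mem_doublyStochastic]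
    norm_num
  · refine exists_perfectMatching h1 ?_
    rw [mem_attachPath_last_castSucc] at h
    simp [expandPath_last_castSucc, h]
  · refine exists_perfectMatching h1 ?_
    rw [mem_attachPath_castSucc_last] at h
    simp [expandPath_castSucc_last, h]
  · rw [mem_attachPath_castSucc_castSucc] at h
    obtain ⟨σ, hσ, hij⟩ := hG _ h
    refine exists_perfectMatching (h0 σ hσ) ?_
    rw [expandPath_castSucc_castSucc]
    dsimp only at hij ⊢
    simp [hij]

/-- The middle edge is covered only by matchings avoiding the old edge, whence `hτ`. -/
theorem IsFaceGraph.replaceEdge (hG : G.IsFaceGraph) (huv : (u, v) ∈ G)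
    (hτ : ∃ τ ∈ G.perfectMatchings, τ u ≠ v) : (G.replaceEdge u v).IsFaceGraph := by
  have h0 : ∀ σ ∈ G.perfectMatchings, subdivide u v (σ.permMatrix ℝ) ∈ (G.replaceEdge u v).face :=
    fun σ hσ => subdivide_mapsTo huv (permMatrix_mem_face hσ)
  obtain ⟨ρ, hρ, hρuv⟩ := hG _ huv
  dsimp only at hρuv
  rintro ⟨i, j⟩
  refine Fin.lastCases ?_ (fun i => ?_) i <;> refine Fin.lastCases ?_ (fun j => ?_) j <;> intro h
  · obtain ⟨τ, hτ, hτuv⟩ := hτ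
    refine exists_perfectMatching (h0 τ hτ) ?_
    rw [subdivide_last_last (permMatrix_mem_face hτ), permMatrix_apply_eq_ite, if_neg hτuv]
    norm_num
  · refine exists_perfectMatching (h0 ρ hρ) ?_
    rw [BipGraph.replaceEdge, mem_attachPath_last_castSucc] at h
    simp [subdivide_apply, expandPath_last_castSucc, h, hρuv]
  · refine exists_perfectMatching (h0 ρ hρ) ?_
    rw [BipGraph.replaceEdge, mem_attachPath_castSucc_last] at h
    simp [subdivide_apply, expandPath_castSucc_last, h, hρuv]
  · rw [BipGraph.replaceEdge, mem_attachPath_castSucc_castSucc] at h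
    obtain ⟨σ, hσ, hij⟩ := hG _ h.1
    refine exists_perfectMatching (h0 σ hσ) ?_
    have hne : ¬(i = u ∧ j = v) := fun h' => h.2 (by simp [h'])
    dsimp only at hij
    rw [subdivide_apply, expandPath_castSucc_castSucc, if_neg hne]
    simp [hij]

theorem IsFaceGraph.replaceEdgeAttachPath (hG : G.IsFaceGraph) (huv : (u, v) ∈ G)
    (hτ : ∃ τ ∈ G.perfectMatchings, τ u ≠ v) : (G.replaceEdgeAttachPath u v).IsFaceGraph :=
  (hG.replaceEdge huv hτ).attachPath mem_attachPath_last_last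

end BipGraph

theorem DefinesFace.combEquiv_attachPath {F E : Set (Matrix (Fin n) (Fin n) ℝ)} {u v : Fin n}
    (hF : IsExposed ℝ (birkhoffPolytope n) F) (hE : IsFacet F E)
    (huF : (u, v) ∈ graphOfFace F) (huE : (u, v) ∉ graphOfFace E)
    {c : Matrix (Fin n) (Fin n) ℝ →ₗ[ℝ] ℝ} {d : ℝ} (h : DefinesFace c d F E) :
    CombEquiv ((graphOfFace F).attachPath u v).face (geometricWedge c d F) := by
  have h1 := BipGraph.combEquiv_face_attachPath huF
  rw [face_graphOfFace hF hE.nonempty] at h1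
  exact h1.trans ((hE.definesFace hF huF huE).combEquiv_wedge h)

theorem DefinesFace.combEquiv_replaceEdgeAttachPath {F E : Set (Matrix (Fin n) (Fin n) ℝ)}
    {u v : Fin n} (hF : IsExposed ℝ (birkhoffPolytope n) F) (hE : IsFacet F E)
    (huF : (u, v) ∈ graphOfFace F) (huE : (u, v) ∉ graphOfFace E)
    {c : Matrix (Fin n) (Fin n) ℝ →ₗ[ℝ] ℝ} {d : ℝ} (h : DefinesFace c d F (faceComplement F E)) :
    CombEquiv ((graphOfFace F).replaceEdgeAttachPath u v).face (geometricWedge c d F) := by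
  have h1 := BipGraph.combEquiv_face_replaceEdgeAttachPath huF
  rw [face_graphOfFace hF hE.nonempty] at h1
  exact h1.trans ((hE.definesFace_faceComplement hF huF huE).combEquiv_wedge h)

/-! ### The Birkhoff polytope of order zero -/

section Zero

variable {F E : Set (Matrix (Fin 0) (Fin 0) ℝ)}

theorem IsFacet.eq_univ_and_eq_empty (hE : IsFacet F E) : F = Set.univ ∧ E = ∅ := by
  have hF : F = Set.univ := Subsingleton.eq_univ_of_nonempty hE.nonempty
  refine ⟨hF, ?_⟩
  by_contra hne
  have h : E = Set.univ := Subsingleton.eq_univ_of_nonempty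
    (Set.nonempty_iff_ne_empty.2 hne)
  exact hE.2.1 (h.trans hF.symm)

theorem IsFacet.faceComplement_eq_self (hE : IsFacet F E) : faceComplement F E = F := by
  obtain ⟨rfl, rfl⟩ := hE.eq_univ_and_eq_empty
  rw [faceComplement, Set.extremePoints_eq_self, Set.sdiff_empty, convexHull_univ]

theorem combEquiv_wedge_self {c : Matrix (Fin 0) (Fin 0) ℝ →ₗ[ℝ] ℝ} {d : ℝ}
    (h : DefinesFace c d F F) : CombEquiv (geometricWedge c d F) F := by
  have hc : ∀ x ∈ F, c x = d := fun x hx => by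
    rw [h.2] at hx
    exact hx.2
  refine CombEquiv.of_affineMap (LinearMap.fst ℝ (Matrix (Fin 0) (Fin 0) ℝ) ℝ).toAffineMap
    (LinearMap.inl ℝ (Matrix (Fin 0) (Fin 0) ℝ) ℝ).toAffineMap (fun p hp => hp.1) (fun x hx => h.mem_wedge_bot hx) ?_
    fun x _ => rfl
  rintro ⟨x, t⟩ ⟨hx, h0, h1⟩
  dsimp only at hx h0 h1
  rw [hc x hx, sub_self] at h1
  exact Prod.ext rfl (le_antisymm h0 h1)

/-- Over the single point, `c` is zero and `d` positive, so the wedge is a segment of length `d`.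
Rescaled, it is the wedge of the one-edge graph, which has order two after attaching a path. -/
theorem combEquiv_wedge_empty (hF : F = Set.univ) {c : Matrix (Fin 0) (Fin 0) ℝ →ₗ[ℝ] ℝ} {d : ℝ}
    (h : DefinesFace c d F ∅) :
    CombEquiv (geometricWedge c d F) (BipGraph.attachPath (n := 1) Set.univ 0 0).face := by
  refine CombEquiv.trans ?_ (BipGraph.combEquiv_face_attachPath (Set.mem_univ _)).symm
  have hc : ∀ x, c x = 0 := fun x => by rw [Subsingleton.elim x 0, map_zero]
  have hd : 0 < d := by
    have h0 : (0 : Matrix (Fin 0) (Fin 0) ℝ) ∈ F := by simp [hF]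
    refine lt_of_le_of_ne (by simpa using h.1 0 h0) fun hd => ?_
    have : (0 : Matrix (Fin 0) (Fin 0) ℝ) ∈ (∅ : Set (Matrix (Fin 0) (Fin 0) ℝ)) := by
      rw [h.2]
      exact ⟨h0, by rw [map_zero, hd]⟩
    exact this
  have hface : ∀ X, X ∈ BipGraph.face (n := 1) Set.univ ↔ X = 1 := by
    intro X
    rw [BipGraph.mem_face_iff, mem_doublyStochastic_iff_sum]
    constructor
    · rintro ⟨⟨-, h, -⟩, -⟩
      ext i j
      rw [Subsingleton.elim i 0, Subsingleton.elim j 0]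
      simpa using h 0
    · rintro rfl
      simp [Subsingleton.elim _ (0 : Fin 1)]
  refine CombEquiv.of_affineMap
    ((AffineMap.const ℝ _ (1 : Matrix (Fin 1) (Fin 1) ℝ)).prod
      (d⁻¹ • LinearMap.snd ℝ (Matrix (Fin 0) (Fin 0) ℝ) ℝ).toAffineMap)
    ((0 : _ →ₗ[ℝ] Matrix (Fin 0) (Fin 0) ℝ).prod
      (d • LinearMap.snd ℝ (Matrix (Fin 1) (Fin 1) ℝ) ℝ)).toAffineMap ?_ ?_ ?_ ?_
  · rintro ⟨x, t⟩ ⟨-, h0, h1⟩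
    simp only [hc, sub_zero] at h0 h1
    refine ⟨(hface _).2 rfl, ?_, ?_⟩
    · simpa using mul_nonneg (inv_nonneg.2 hd.le) h0
    · simpa [inv_mul_eq_div] using (div_le_one hd).2 h1
  · rintro ⟨X, t⟩ ⟨hX, h0, h1⟩
    obtain rfl := (hface X).1 hX
    refine ⟨by simp [hF], ?_, ?_⟩
    · simpa using mul_nonneg hd.le h0
    · have h2 : t ≤ 1 := by simpa using h1
      simpa using mul_le_of_le_one_right hd.le h2
  · rintro ⟨x, t⟩ -
    refine Prod.ext (Subsingleton.elim _ _) ?_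
    simp [hd.ne']
  · rintro ⟨X, t⟩ ⟨hX, -, -⟩
    obtain rfl := (hface X).1 hX
    refine Prod.ext rfl ?_
    simp [hd.ne']

end Zero

end Birkhoff

/-! ### The main theorem -/

theorem mainTheorem5 (n : ℕ) (F E : Set (Matrix (Fin n) (Fin n) ℝ))
    (hF : IsExposed ℝ (birkhoffPolytope n) F) (hE : IsFacet F E) :
    IsExposed ℝ F (faceComplement F E) ∧
    (∀ (k : ℕ) (W : Set (EuclideanSpace ℝ (Fin k))),
      IsWedge W F E ∨ IsWedge W F (faceComplement F E) →
        ∃ m : ℕ, n ≤ m ∧ ∃ F' : Set (Matrix (Fin m) (Fin m) ℝ),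
          IsExposed ℝ (birkhoffPolytope m) F' ∧ CombEquiv W F') ∧
    (∀ C : Set (Fin n × Fin n), IsFacetDefiningSet F E C → ∀ u v : Fin n, (u, v) ∈ C →
      (((graphOfFace F).attachPath u v).IsFaceGraph ∧
        IsExposed ℝ (birkhoffPolytope (n + 1)) ((graphOfFace F).attachPath u v).face ∧
        IsWedge ((graphOfFace F).attachPath u v).face F E) ∧
      ((E.Nonempty → ((graphOfFace F).replaceEdgeAttachPath u v).IsFaceGraph) ∧
        IsExposed ℝ (birkhoffPolytope (n + 2)) ((graphOfFace F).replaceEdgeAttachPath u v).face ∧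
        IsWedge ((graphOfFace F).replaceEdgeAttachPath u v).face F (faceComplement F E))) := by
  refine ⟨?_, ?_, ?_⟩
  · rcases Nat.eq_zero_or_pos n with rfl | hn
    · rw [hE.faceComplement_eq_self]
    · obtain ⟨u, v, huF, huE⟩ := hE.exists_edge hF hn
      exact (hE.definesFace_faceComplement hF huF huE).isExposed
  · intro k W hW
    rcases Nat.eq_zero_or_pos n with rfl | hn
    · rw [hE.faceComplement_eq_self] at hW
      rcases hW with ⟨-, c, d, hcd, hW⟩ | ⟨-, c, d, hcd, hW⟩
      · obtain ⟨hFu, rfl⟩ := hE.eq_univ_and_eq_empty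
        exact ⟨2, Nat.zero_le _, _, BipGraph.isExposed_face _,
          hW.trans (combEquiv_wedge_empty hFu hcd)⟩
      · exact ⟨0, le_rfl, F, hF, hW.trans (combEquiv_wedge_self hcd)⟩
    · obtain ⟨u, v, huF, huE⟩ := hE.exists_edge hF hn
      rcases hW with ⟨-, c, d, hcd, hW⟩ | ⟨-, c, d, hcd, hW⟩
      · exact ⟨n + 1, by omega, _, BipGraph.isExposed_face _,
          hW.trans (hcd.combEquiv_attachPath hF hE huF huE).symm⟩
      · exact ⟨n + 2, by omega, _, BipGraph.isExposed_face _,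
          hW.trans (hcd.combEquiv_replaceEdgeAttachPath hF hE huF huE).symm⟩
  · intro C hC u v huv
    have huF : (u, v) ∈ graphOfFace F := hC.1 huv
    have huE : (u, v) ∉ graphOfFace E := by
      rw [← hC.2]
      exact fun h => h.2 huv
    have hE0 := hE.definesFace hF huF huE
    have hE1 := hE.definesFace_faceComplement hF huF huE
    refine ⟨⟨isFaceGraph_graphOfFace.attachPath huF, BipGraph.isExposed_face _,
      BipGraph.isPolytope_face _, _, _, hE0, hE0.combEquiv_attachPath hF hE huF huE⟩,
      fun hne => isFaceGraph_graphOfFace.replaceEdgeAttachPath huF ?_, BipGraph.isExposed_face _,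
      BipGraph.isPolytope_face _, _, _, hE1, hE1.combEquiv_replaceEdgeAttachPath hF hE huF huE⟩
    -- A nonempty `E` contains a permutation matrix, whose matching avoids `(u, v)`.
    rw [hE.eq_convexHull_permMatrix hF, convexHull_nonempty_iff] at hne
    obtain ⟨_, ⟨τ, rfl⟩, hτ⟩ := hne
    exact ⟨τ, fun i => ⟨τ, hE.1.subset hτ, rfl⟩, fun h => huE ⟨τ, hτ, h⟩⟩
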